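/- Let $k$ be a commutative ring; all algebras are commutative and unital over $k$. Let $\mathbf E$ be a simplicial $k$-algebra that is free in the step-by-step sense: there are sets $X_n$ ($n\ge 0$) of generators $X_n\to E_n$, with $d_i s=0$ for all $s\in X_n$ and $0\le i<n$ (only the last face may be nonzero), such that each $E_n$ is the polynomial $k$-algebra on the degeneracies $\sigma^*s$, where $s\in X_m$ and $\sigma:[n]\twoheadrightarrow[m]$ is a monotone surjection. For $m\ge 0$ let $\mathbf E^{(m)}\subseteq\mathbf E$ be the $m$-skeleton, the simplicial subalgebra generated by the simplices of dimension $\le m$; its generators are the sets $X_n$ with $n\le m$. Assume that $\mathbf E$ is a simplicial resolution of a $k$-algebra $B$: there is a surjective homomorphism $\varepsilon:E_0\to B$ with kernel $d_1(\operatorname{Ker}d_0)$, so that $\pi_0(\mathbf E)\cong B$, and $\pi_n(\mathbf E)=0$ for $n\ge1$. For a simplicial algebra $\mathbf F$ let $NF_n=\bigcap_{i<n}\operatorname{Ker}(d_i:F_n\to F_{n-1})$ be its Moore complex, with differential $\partial_n$ the restriction of $d_n$, and let $D_n\subseteq F_n$ be the subalgebra generated by the degenerate elements. For $n\ge3$ the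 $n$-th term of the 2-crossed complex of $\mathbf F$ is $$\mathbf C^{(2)}(\mathbf F)_n=\frac{NF_n}{(NF_n\cap D_n)+\partial_{n+1}(NF_{n+1}\cap D_{n+1})},$$ on which $F_0$ acts by multiplication through the iterated degeneracy $F_0\to F_n$. Then for every $n\ge 3$: (a) for every $m\ge1$, and in particular for $m=2$, the action of $E_0$ on $\mathbf C^{(2)}(\mathbf E^{(m)})_n$ induces through $\varepsilon$ a $B$-module structure, and this $B$-module is free with basis the classes of the $n$-dimensional generators of $\mathbf E^{(m)}$, that is, of the $s\in X_n$ if $n\le m$, and with empty basis if $n>m$; (b) likewise, $\mathbf C^{(2)}(\mathbf E)_n$ is a free $B$-module with basis the classes of the generators $s\in X_n$. -/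

import Mathlib

open CategoryTheory Opposite Simplicial

universe u v w z

namespace SimplicialAlgebra

variable {k : Type u} [CommRing k] (E : SimplicialObject (CommAlgCat.{v} k))

/-- The algebra of `n`-simplices. -/
abbrev Alg (n : ℕ) : Type v := E.obj (op ⦋n⦌)

/-- The algebra homomorphism `E_m → E_n` induced by a monotone map `[n] → [m]`. -/
def pull {n m : ℕ} (f : ⦋n⦌ ⟶ ⦋m⦌) : Alg E m →ₐ[k] Alg E n := (E.map f.op).hom

/-- The face `d_i : E_{n+1} → E_n`. -/
def face (n : ℕ) (i : Fin (n + 2)) : Alg E (n + 1) →ₐ[k] Alg E n := (E.δ i).hom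

/-- The degeneracy `s_i : E_n → E_{n+1}`. -/
def degen (n : ℕ) (i : Fin (n + 1)) : Alg E n →ₐ[k] Alg E (n + 1) := (E.σ i).hom

/-- The iterated degeneracy `E_0 → E_n`, induced by the unique map `[n] → [0]`. -/
def totalDegen (n : ℕ) : Alg E 0 →ₐ[k] Alg E n := pull E (SimplexCategory.const ⦋n⦌ ⦋0⦌ 0)

/-- The `n`-th term `NE_n = ⋂_{i < n} Ker d_i` of the Moore complex, as an ideal of `E_n`. -/
def moore (n : ℕ) : Ideal (Alg E n) :=
  match n with
  | 0 => ⊤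
  | n + 1 => ⨅ i : Fin (n + 1), RingHom.ker (face E n i.castSucc)

/-- The differential `∂_{n+1}`, which is the restriction of the last face `d_{n+1}`. -/
def lastFace (n : ℕ) : Alg E (n + 1) →ₐ[k] Alg E n := face E n (Fin.last (n + 1))

/-- `D_n`: the subalgebra of `E_n` generated by the degenerate elements `s_i y`. -/
def degenerate (n : ℕ) : Subalgebra k (Alg E n) :=
  match n with
  | 0 => ⊥
  | n + 1 => Algebra.adjoin k {x | ∃ (i : Fin (n + 1)) (y : Alg E n), x = degen E n i y}

/-- `NE_n` as a module over the ground ring. -/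
abbrev mooreModule (n : ℕ) : Submodule k (Alg E n) := (moore E n).restrictScalars k

/-- `∂_{n+1}(NE_{n+1} ∩ D_{n+1})`. -/
def degenerateBoundary (n : ℕ) : Submodule k (Alg E n) :=
  (mooreModule E (n + 1) ⊓ Subalgebra.toSubmodule (degenerate E (n + 1))).map
    (lastFace E n).toLinearMap

/-- The submodule of `E_n` (contained in `NE_n`) by which `NE_n` is divided in order to obtain
the `n`-th term of the 2-crossed complex of `E`. -/
def relations (n : ℕ) : Submodule k (Alg E n) :=
  match n with
  | 0 => ⊥
  | 1 => ⊥
  | 2 => degenerateBoundary E 2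
  | n + 3 => (mooreModule E (n + 3) ⊓ Subalgebra.toSubmodule (degenerate E (n + 3))) ⊔
      degenerateBoundary E (n + 3)

/-- The `n`-th term of the 2-crossed complex of `E`:
`NE_n` for `n = 0, 1`, `NE_2 / ∂_3(NE_3 ∩ D_3)` for `n = 2`, and
`NE_n / ((NE_n ∩ D_n) + ∂_{n+1}(NE_{n+1} ∩ D_{n+1}))` for `n ≥ 3`. -/
abbrev TwoCrossedTerm (n : ℕ) : Type v :=
  (mooreModule E n) ⧸ (relations E n).comap (mooreModule E n).subtype

/-- The class in the `n`-th term of the 2-crossed complex of an element of `NE_n`. -/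
def termMk (n : ℕ) (x : moore E n) : TwoCrossedTerm E n :=
  Submodule.Quotient.mk (p := (relations E n).comap (mooreModule E n).subtype) x

/-- `E_0` acts on `NE_n` by multiplication through the iterated degeneracy `E_0 → E_n`. -/
def mooreAct (n : ℕ) (r : Alg E 0) (x : moore E n) : moore E n :=
  ⟨totalDegen E n r * x.1, (moore E n).mul_mem_left _ x.2⟩

/-- Let `ε : E_0 → B` be an algebra homomorphism (it is surjective in the applications).
The action of `E_0` on `NE_n` induces, through `ε`, a `B`-module structure on the `n`-th term of
the 2-crossed complex of `E`, and this `B`-module is free with basis the classes of the `v i`. -/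
def IsFreeTermOn {B : Type w} [CommRing B] [Algebra k B] (ε : Alg E 0 →ₐ[k] B) (n : ℕ)
    {ι : Type z} (v : ι → moore E n) : Prop :=
  ∃ _ : Module B (TwoCrossedTerm E n),
    (∀ (r : Alg E 0) (x : moore E n), ε r • termMk E n x = termMk E n (mooreAct E n r x)) ∧
    ∃ b : Module.Basis ι B (TwoCrossedTerm E n), ∀ i, b i = termMk E n (v i)

/-- Construction data exhibiting `E` as a free simplicial algebra in the step-by-step sense:
sets `gen n` of non-degenerate generators in each dimension `n`, all of whose faces except the
last one vanish, such that each `E_n` is the polynomial algebra over the ground ring on the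
degeneracies `σ^* s` of the generators (`s ∈ gen m`, `σ : [n] ↠ [m]`). -/
structure ConstructionData where
  gen : ℕ → Type z
  elt : ∀ n, gen n → Alg E n
  face_elt : ∀ (n : ℕ) (s : gen (n + 1)) (i : Fin (n + 1)),
    face E n i.castSucc (elt (n + 1) s) = 0
  free : ∀ n : ℕ, Function.Bijective
    (MvPolynomial.aeval (R := k)
      (fun p : (Σ m : ℕ, {f : ⦋n⦌ ⟶ ⦋m⦌ // Epi f} × gen m) =>
        pull E p.2.1.1 (elt p.1 p.2.2)))

variable {E} in
lemma ConstructionData.elt_mem_moore (X : ConstructionData.{u, v, z} E) (n : ℕ) (s : X.gen n) :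
    X.elt n s ∈ moore E n := by
  cases n with
  | zero => exact Submodule.mem_top
  | succ n => exact (Submodule.mem_iInf _).2 fun i => X.face_elt n s i

variable {E} in
/-- The generators in dimension `n`, as elements of `NE_n`. -/
def ConstructionData.mooreElt (X : ConstructionData.{u, v, z} E) (n : ℕ) (s : X.gen n) :
    moore E n := ⟨X.elt n s, X.elt_mem_moore n s⟩

/-- The augmentation `ε : E_0 → B` makes `E` a simplicial resolution of `B` (for a free simplicial
algebra `E`): `ε` induces `π_0(E) ≅ B`, and `π_n(E) = 0` for `n ≥ 1`. -/
structure IsResolution {B : Type w} [CommRing B] [Algebra k B] (ε : Alg E 0 →ₐ[k] B) : Prop where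
  surjective : Function.Surjective ε
  ker_eq : ∀ r : Alg E 0, ε r = 0 ↔ ∃ x ∈ moore E 1, lastFace E 0 x = r
  acyclic : ∀ (n : ℕ), ∀ x ∈ moore E (n + 1), lastFace E n x = 0 →
    ∃ y ∈ moore E (n + 2), lastFace E (n + 1) y = x

/-- The algebra of `n`-simplices of the `m`-skeleton: the subalgebra of `E_n` generated by the
images of all the simplices of dimension at most `m`. -/
def skelAlg (m n : ℕ) : Subalgebra k (Alg E n) :=
  Algebra.adjoin k {x | ∃ (j : ℕ) (_ : j ≤ m) (f : ⦋n⦌ ⟶ ⦋j⦌) (y : Alg E j), x = pull E f y}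

lemma pull_comp {a b c : ℕ} (f : ⦋a⦌ ⟶ ⦋b⦌) (g : ⦋b⦌ ⟶ ⦋c⦌) (x : Alg E c) :
    pull E f (pull E g x) = pull E (f ≫ g) x := by
  simp [pull]

lemma pull_id {a : ℕ} (x : Alg E a) : pull E (𝟙 ⦋a⦌) x = x := by
  simp [pull]

lemma skelAlg_le (m : ℕ) {a b : ℕ} (f : ⦋a⦌ ⟶ ⦋b⦌) :
    skelAlg E m b ≤ (skelAlg E m a).comap (pull E f) := by
  refine Algebra.adjoin_le ?_
  rintro x ⟨j, hj, g, y, rfl⟩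
  refine Algebra.subset_adjoin ⟨j, hj, f ≫ g, y, pull_comp E f g y⟩

/-- The structure maps of the `m`-skeleton. -/
def skelMap (m : ℕ) {a b : ℕ} (f : ⦋a⦌ ⟶ ⦋b⦌) : skelAlg E m b →ₐ[k] skelAlg E m a :=
  ((pull E f).comp (skelAlg E m b).val).codRestrict (skelAlg E m a)
    fun x => skelAlg_le E m f x.2

/-- The `m`-skeleton `E^(m)` of a free simplicial algebra `E`, as a simplicial subalgebra of `E`:
it is generated by the simplices of dimension at most `m`. -/
def skel (m : ℕ) : SimplicialObject (CommAlgCat.{v} k) where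
  obj a := CommAlgCat.of k (skelAlg E m a.unop.len)
  map f := CommAlgCat.ofHom (skelMap E m f.unop)
  map_id a := by
    refine CommAlgCat.hom_ext (AlgHom.ext fun x => Subtype.ext ?_)
    exact pull_id E x.1
  map_comp f g := by
    refine CommAlgCat.hom_ext (AlgHom.ext fun x => Subtype.ext ?_)
    exact (pull_comp E g.unop f.unop x.1).symm

/-- The inclusion of the `m`-skeleton. -/
def skelIncl (m n : ℕ) : Alg (skel E m) n →ₐ[k] Alg E n := (skelAlg E m n).val

variable {E} in
/-- The generators of dimension `n` lying in the `m`-skeleton (that is, all of them if `n ≤ m`,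
and none otherwise), as elements of the Moore complex of the `m`-skeleton. -/
def ConstructionData.skelElt (X : ConstructionData.{u, v, z} E) (m n : ℕ)
    (s : {_s : X.gen n // n ≤ m}) : moore (skel E m) n :=
  ⟨(⟨X.elt n s.1, Algebra.subset_adjoin ⟨n, s.2, 𝟙 _, X.elt n s.1, (pull_id E _).symm⟩⟩ :
      skelAlg E m n), by
    obtain ⟨s, hs⟩ := s
    cases n with
    | zero => exact Submodule.mem_top
    | succ n => exact (Submodule.mem_iInf _).2 fun i => Subtype.ext (X.face_elt n s i)⟩

end SimplicialAlgebra

/-! Spanning and independence have separate sources. Spanning: for `x` in the Moore complex,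
Peiffer-type alternating sums of products of degenerate elements with `s_i x` lie in `NE ∩ D` one
dimension up. Their last faces show that, modulo the relations, `e * x` depends only on the value of
`e` at its initial vertex, and that `∂NE_1` acts as zero
(`totalDegen_vertex_sub_mul_mem_fullRelations`, `totalDegen_lastFace_mul_mem_fullRelations`). So all
of `E_n` acts through `B`. Since `E_n` is generated as an algebra by `D_n` and the `n`-dimensional
generators, the classes of these generators span. Independence: let `I_n` be the kernel of the
augmentation `E_n → B`. The quotient `I/I²` is a simplicial abelian group, where normalized
degenerate elements vanish; hence `NE ∩ D ⊆ I²` (`mem_augIdeal_sq_of_mem_moore`). For each generator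
`s`, a homomorphism from `E_n` to the dual numbers over `B` kills `I²` and has no infinitesimal part
on `D_n`, so its infinitesimal part is a coordinate functional on the quotient, dual to `s`. Both
halves meet in `isFreeTermOn_of_functionals`. It applies equally to a skeleton, whose coordinates
are the restrictions of those of `E`. -/

namespace SimplicialAlgebra

/-! ### Simplicial identities on the Moore complex and the submodule of relations. -/

section Basic

variable {k : Type u} [CommRing k] (E : SimplicialObject (CommAlgCat.{v} k))

lemma lastFace_eq_pull (n : ℕ) :
    lastFace E n = pull E (SimplexCategory.δ (Fin.last (n + 1))) := rfl

lemma degen_eq_pull (n : ℕ) (i : Fin (n + 1)) :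
    degen E n i = pull E (SimplexCategory.σ i) := rfl

lemma mem_moore_succ {n : ℕ} {x : Alg E (n + 1)} :
    x ∈ moore E (n + 1) ↔ ∀ i : Fin (n + 1), pull E (SimplexCategory.δ i.castSucc) x = 0 := by
  change x ∈ (⨅ i : Fin (n + 1), RingHom.ker (face E n i.castSucc)) ↔ _
  rw [Submodule.mem_iInf]
  rfl

/-- Pulling back along a map that misses a vertex other than the last one kills the Moore
complex. -/
lemma pull_eq_zero_of_forall_ne {n : ℕ} {a : ℕ} (h : ⦋a⦌ ⟶ ⦋n + 1⦌) (i : Fin (n + 1))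
    (hi : ∀ v, h.toOrderHom v ≠ i.castSucc) {x : Alg E (n + 1)} (hx : x ∈ moore E (n + 1)) :
    pull E h x = 0 := by
  obtain ⟨θ, rfl⟩ := SimplexCategory.eq_comp_δ_of_not_surjective' h i.castSucc hi
  rw [← pull_comp, (mem_moore_succ E).1 hx, map_zero]

lemma not_injective_of_lt {n m : ℕ} (h : m < n) (f : ⦋n⦌ ⟶ ⦋m⦌) :
    ¬ Function.Injective f.toOrderHom := fun hf => by
  have := Fintype.card_le_of_injective _ hf
  simp at this
  omega

lemma exists_eq_σ_comp {n m : ℕ} (h : m < n + 1) (f : ⦋n + 1⦌ ⟶ ⦋m⦌) :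
    ∃ (i : Fin (n + 1)) (g : ⦋n⦌ ⟶ ⦋m⦌), f = SimplexCategory.σ i ≫ g :=
  SimplexCategory.eq_σ_comp_of_not_injective f (not_injective_of_lt h f)

lemma degen_mem_degenerate (n : ℕ) (i : Fin (n + 1)) (y : Alg E n) :
    pull E (SimplexCategory.σ i) y ∈ degenerate E (n + 1) :=
  Algebra.subset_adjoin ⟨i, y, rfl⟩

lemma pull_mem_degenerate {n m : ℕ} (h : m < n) (f : ⦋n⦌ ⟶ ⦋m⦌) (y : Alg E m) :
    pull E f y ∈ degenerate E n := by
  obtain _ | n := n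
  · omega
  obtain ⟨i, g, rfl⟩ := exists_eq_σ_comp h f
  rw [← pull_comp]
  exact degen_mem_degenerate E n i _

lemma δ_apply_val {n : ℕ} (j : Fin (n + 2)) (v : Fin (n + 1)) :
    ((SimplexCategory.δ j).toOrderHom v : ℕ) = if (v : ℕ) < j then (v : ℕ) else v + 1 := by
  change (j.succAbove v : ℕ) = _
  simp only [Fin.succAbove, Fin.lt_def, Fin.val_castSucc]
  split_ifs <;> simp

lemma σ_apply_val {n : ℕ} (i : Fin (n + 1)) (v : Fin (n + 2)) :
    ((SimplexCategory.σ i).toOrderHom v : ℕ) = if (i : ℕ) < v then (v : ℕ) - 1 else v := by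
  change (i.predAbove v : ℕ) = _
  simp only [Fin.predAbove, Fin.lt_def, Fin.val_castSucc]
  split_ifs <;> simp

/-- Away from `j = i, i + 1` the simplicial identities rewrite `d_j s_i` as a degeneracy of `d_j` or
`d_{j-1}`, and neither is the last face because `j` is not the last index. -/
lemma pull_δ_σ_eq_zero {n : ℕ} {x : Alg E (n + 1)} (hx : x ∈ moore E (n + 1))
    (j i : Fin (n + 2)) (h₁ : (j : ℕ) ≠ i) (h₂ : (j : ℕ) ≠ i + 1) :
    pull E (SimplexCategory.δ j.castSucc) (pull E (SimplexCategory.σ i) x) = 0 := by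
  have hval (v : Fin (n + 2)) : ((SimplexCategory.δ j.castSucc ≫
      SimplexCategory.σ i).toOrderHom v : ℕ) = if (v : ℕ) < j then
        (if (i : ℕ) < v then (v : ℕ) - 1 else v)
        else (if (i : ℕ) < v + 1 then (v : ℕ) else v + 1) := by
    change ((SimplexCategory.σ i).toOrderHom ((SimplexCategory.δ j.castSucc).toOrderHom v) : ℕ) = _
    rw [σ_apply_val, δ_apply_val, Fin.val_castSucc]
    split_ifs <;> simp
  rw [pull_comp]
  rcases lt_or_gt_of_ne h₁ with h | h
  · refine pull_eq_zero_of_forall_ne E _ ⟨j, by omega⟩ (fun v e => ?_) hx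
    have := (hval v).symm.trans (congrArg Fin.val e)
    simp only [Fin.val_castSucc] at this
    split_ifs at this <;> omega
  · refine pull_eq_zero_of_forall_ne E _ ⟨j - 1, by omega⟩ (fun v e => ?_) hx
    have := (hval v).symm.trans (congrArg Fin.val e)
    simp only [Fin.val_castSucc] at this
    split_ifs at this <;> omega

lemma pull_δ_σ_self {n : ℕ} (i : Fin (n + 1)) (x : Alg E n) :
    pull E (SimplexCategory.δ i.castSucc) (pull E (SimplexCategory.σ i) x) = x := by
  rw [pull_comp, SimplexCategory.δ_comp_σ_self, pull_id]

lemma pull_δ_σ_succ {n : ℕ} (i : Fin (n + 1)) (x : Alg E n) :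
    pull E (SimplexCategory.δ i.succ) (pull E (SimplexCategory.σ i) x) = x := by
  rw [pull_comp, SimplexCategory.δ_comp_σ_succ, pull_id]

/-- The submodule `(NE_n ∩ D_n) + ∂(NE_{n+1} ∩ D_{n+1})` of `E_n`. -/
def fullRelations (n : ℕ) : Submodule k (Alg E n) :=
  (mooreModule E n ⊓ Subalgebra.toSubmodule (degenerate E n)) ⊔ degenerateBoundary E n

lemma relations_eq {n : ℕ} (hn : 3 ≤ n) : relations E n = fullRelations E n := by
  obtain ⟨n, rfl⟩ := Nat.exists_eq_add_of_le' hn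
  rfl

lemma mem_fullRelations_of_degenerate {n : ℕ} {x : Alg E n} (hx : x ∈ moore E n)
    (h : x ∈ degenerate E n) : x ∈ fullRelations E n :=
  Submodule.mem_sup_left ⟨hx, h⟩

lemma lastFace_mem_fullRelations {n : ℕ} {x : Alg E (n + 1)} (hx : x ∈ moore E (n + 1))
    (h : x ∈ degenerate E (n + 1)) :
    pull E (SimplexCategory.δ (Fin.last (n + 1))) x ∈ fullRelations E n :=
  Submodule.mem_sup_right ⟨x, ⟨hx, h⟩, rfl⟩

lemma lastFace_mem_moore {n : ℕ} {x : Alg E (n + 1)} (hx : x ∈ moore E (n + 1)) :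
    pull E (SimplexCategory.δ (Fin.last (n + 1))) x ∈ moore E n := by
  obtain _ | n := n
  · exact Submodule.mem_top
  refine (mem_moore_succ E).2 fun i => ?_
  rw [pull_comp]
  refine pull_eq_zero_of_forall_ne E _ i.castSucc ?_ hx
  rintro v e
  have h₁ : ((SimplexCategory.δ (Fin.last (n + 2))).toOrderHom
      ((SimplexCategory.δ i.castSucc).toOrderHom v) : ℕ) = i := congrArg Fin.val e
  rw [δ_apply_val, δ_apply_val] at h₁
  simp only [Fin.val_castSucc, Fin.val_last] at h₁
  split_ifs at h₁ <;> omega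

lemma fullRelations_le (n : ℕ) : fullRelations E n ≤ mooreModule E n := by
  refine sup_le inf_le_left ?_
  rintro _ ⟨x, hx, rfl⟩
  exact lastFace_mem_moore E hx.1

end Basic

/-! ### Peiffer-type elements of the Moore complex. -/

section Peiffer

variable {k : Type u} [CommRing k] (E : SimplicialObject (CommAlgCat.{v} k))

/-- Under `d_j` only the terms with `s_{j-1} x` and `s_j x` survive. Both degeneracies become `x`,
and the coefficients cancel because `d_j φ_j = d_j φ_{j+1}`. For `j = 0` only `s_0 x` is left;
subtracting `φ 0` makes its coefficient vanish. -/
lemma alternatingSum_mem_moore {n : ℕ} {x : Alg E (n + 1)} (hx : x ∈ moore E (n + 1))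
    (φ : Fin (n + 3) → Alg E (n + 2))
    (h : ∀ i : Fin (n + 2), pull E (SimplexCategory.δ i.castSucc) (φ i.castSucc) =
      pull E (SimplexCategory.δ i.castSucc) (φ i.succ)) :
    ∑ i : Fin (n + 2), (-1) ^ (i : ℕ) * ((φ i.succ - φ 0) * pull E (SimplexCategory.σ i) x) ∈
      moore E (n + 2) := by
  refine (mem_moore_succ E).2 fun j => ?_
  rw [map_sum]
  simp only [map_mul, map_sub, map_pow, map_neg, map_one]
  induction j using Fin.cases with
  | zero =>
    refine Finset.sum_eq_zero fun i _ => ?_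
    induction i using Fin.cases with
    | zero =>
      rw [← h 0]
      simp
    | succ i =>
      rw [pull_δ_σ_eq_zero E hx 0 i.succ (by simp) (by simp)]
      simp
  | succ j =>
    rw [Fintype.sum_eq_add (j.castSucc) j.succ (by simp [Fin.ext_iff])]
    · have h₁ := pull_δ_σ_self E j.succ x
      have h₂ : pull E (SimplexCategory.δ j.succ.castSucc)
          (pull E (SimplexCategory.σ j.castSucc) x) = x := pull_δ_σ_succ E j.castSucc x
      rw [h₁, h₂, ← h j.succ, Fin.succ_castSucc]
      simp only [Fin.val_castSucc, Fin.val_succ]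
      ring
    · rintro i ⟨hi₁, hi₂⟩
      rw [pull_δ_σ_eq_zero E hx j.succ i (fun e => hi₂ (Fin.ext e.symm))
        (fun e => hi₁ (Fin.ext (by simpa using e.symm)))]
      simp

/-- The alternating sum is degenerate, so its last face is a relation. In that face every term but
the final one is degenerate, since the last face commutes past `s_i`; the final term is the stated
product up to sign. -/
theorem sub_mul_mem_fullRelations {n : ℕ} {x : Alg E (n + 1)} (hx : x ∈ moore E (n + 1))
    (φ : Fin (n + 3) → Alg E (n + 2)) (hφ : ∀ i, φ i ∈ degenerate E (n + 2))
    (h : ∀ i : Fin (n + 2), pull E (SimplexCategory.δ i.castSucc) (φ i.castSucc) =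
      pull E (SimplexCategory.δ i.castSucc) (φ i.succ))
    (hlast : ∀ i : Fin (n + 1),
      pull E (SimplexCategory.δ (Fin.last (n + 2))) (φ i.castSucc.succ - φ 0) ∈
        degenerate E (n + 1)) :
    pull E (SimplexCategory.δ (Fin.last (n + 2))) (φ (Fin.last (n + 2)) - φ 0) * x ∈
      fullRelations E (n + 1) := by
  have key := lastFace_mem_fullRelations E (alternatingSum_mem_moore E hx φ h)
    (Subalgebra.sum_mem _ fun i _ => Subalgebra.mul_mem _
      (Subalgebra.pow_mem _ (Subalgebra.neg_mem _ (Subalgebra.one_mem _)) _)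
      (Subalgebra.mul_mem _ (Subalgebra.sub_mem _ (hφ _) (hφ _))
        (degen_mem_degenerate E (n + 1) i x)))
  rw [map_sum, Fin.sum_univ_castSucc] at key
  have hσ : pull E (SimplexCategory.δ (Fin.last (n + 2)))
      (pull E (SimplexCategory.σ (Fin.last (n + 1))) x) = x := pull_δ_σ_succ E (Fin.last (n + 1)) x
  simp only [map_mul, map_pow, map_neg, map_one, Fin.val_last] at key
  rw [hσ, Fin.succ_last] at key
  have hprod : pull E (SimplexCategory.δ (Fin.last (n + 2))) (φ (Fin.last (n + 2)) - φ 0) * x ∈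
      moore E (n + 1) := Ideal.mul_mem_left _ _ hx
  set y := pull E (SimplexCategory.δ (Fin.last (n + 2))) (φ (Fin.last (n + 2)) - φ 0) * x
  have hy : (-1) ^ (n + 1) * y ∈ mooreModule E (n + 1) := Ideal.mul_mem_left _ _ hprod
  have hR := (Submodule.add_mem_iff_right _ ?_).1 key
  · rcases neg_one_pow_eq_or (Alg E (n + 1)) (n + 1) with e | e
    · rwa [e, one_mul] at hR
    · rw [e, neg_one_mul] at hR
      exact (Submodule.neg_mem_iff _).1 hR
  · refine mem_fullRelations_of_degenerate E ?_ ?_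
    -- The remaining terms are normalized only jointly: the whole face and its final term are in the
    -- Moore complex, hence so is their difference.
    · exact (Submodule.add_mem_iff_left _ hy).1 (fullRelations_le E _ key)
    · refine Subalgebra.sum_mem _ fun i _ => Subalgebra.mul_mem _
        (Subalgebra.pow_mem _ (Subalgebra.neg_mem _ (Subalgebra.one_mem _)) _)
        (Subalgebra.mul_mem _ (hlast i) ?_)
      have : SimplexCategory.δ (Fin.last (n + 2)) ≫ SimplexCategory.σ i.castSucc =
          SimplexCategory.σ i ≫ SimplexCategory.δ (Fin.last (n + 1)) := by
        have := SimplexCategory.δ_comp_σ_of_gt (n := n) (i := Fin.last (n+1)) (j := i)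
          (by simpa [Fin.lt_def] using Nat.lt_succ_iff.1 i.2)
        exact this
      rw [pull_comp, this, ← pull_comp]
      exact degen_mem_degenerate E n i _

end Peiffer

/-! ### The action of `E_n` on its Moore complex modulo the relations. -/

section Action

variable {k : Type u} [CommRing k] (E : SimplicialObject (CommAlgCat.{v} k))

/-- The map that agrees with `g` from the vertex `c` on, and is `0` before `c`. -/
def truncMap {a m : ℕ} (g : ⦋a⦌ ⟶ ⦋m⦌) (c : ℕ) : ⦋a⦌ ⟶ ⦋m⦌ :=
  SimplexCategory.Hom.mk ⟨fun v => if (v : ℕ) < c then 0 else g.toOrderHom v, fun v w h => by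
    have h' : (v : ℕ) ≤ w := h
    dsimp only
    split_ifs
    · exact le_rfl
    · exact Fin.zero_le _
    · omega
    · exact g.toOrderHom.monotone h⟩

lemma truncMap_apply {a m : ℕ} (g : ⦋a⦌ ⟶ ⦋m⦌) (c : ℕ) (v : Fin (a + 1)) :
    (truncMap g c).toOrderHom v = if (v : ℕ) < c then 0 else g.toOrderHom v := rfl

lemma hom_ext {a m : ℕ} {f g : ⦋a⦌ ⟶ ⦋m⦌}
    (h : ∀ v : Fin (a + 1), f.toOrderHom v = g.toOrderHom v) : f = g :=
  SimplexCategory.Hom.ext _ _ (OrderHom.ext _ _ (funext h))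

lemma comp_apply {a b c : ℕ} (f : ⦋a⦌ ⟶ ⦋b⦌) (g : ⦋b⦌ ⟶ ⦋c⦌) (v : Fin (a + 1)) :
    (f ≫ g).toOrderHom v = g.toOrderHom (f.toOrderHom v) := rfl

/-- The map `h` is deformed to the constant map one vertex at a time. Successive truncations at `i`
and `i + 1` differ only at vertex `i`, which the face `d_i` omits, so they form an admissible family
`φ`. -/
lemma const_sub_pull_mul_mem_fullRelations {n m : ℕ} (hm : m < n + 1) (h : ⦋n + 1⦌ ⟶ ⦋m⦌)
    (e : Alg E m) {x : Alg E (n + 1)} (hx : x ∈ moore E (n + 1)) :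
    (pull E (SimplexCategory.const ⦋n + 1⦌ ⦋m⦌ 0) e - pull E h e) * x ∈
      fullRelations E (n + 1) := by
  have hlt : m < n + 2 := by omega
  have key := sub_mul_mem_fullRelations E hx
    (fun i => pull E (truncMap (SimplexCategory.σ (Fin.last (n + 1)) ≫ h) i) e)
    (fun i => pull_mem_degenerate E hlt _ _) (fun i => ?_) (fun i => ?_)
  · simp only [map_sub, pull_comp] at key
    convert key using 5
    · refine hom_ext fun v => ?_
      rw [comp_apply, truncMap_apply, δ_apply_val, if_pos]
      · rfl
      · simp only [Fin.val_last]
        have := v.2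
        split_ifs <;> omega
    · refine hom_ext fun v => ?_
      rw [comp_apply, truncMap_apply, if_neg (by simp), ← comp_apply, ← Category.assoc,
        ← Fin.succ_last, SimplexCategory.δ_comp_σ_succ, Category.id_comp]
  · rw [pull_comp, pull_comp]
    congr 2
    refine hom_ext fun v => ?_
    rw [comp_apply, comp_apply, truncMap_apply, truncMap_apply, δ_apply_val]
    simp only [Fin.val_castSucc, Fin.val_succ]
    congr 1
    split_ifs <;> simp <;> omega
  · rw [map_sub, pull_comp, pull_comp]
    exact Subalgebra.sub_mem _ (pull_mem_degenerate E hm _ _) (pull_mem_degenerate E hm _ _)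

/-- The element `e` need not be degenerate, so the truncation argument does not reach it. The family
here is constantly `s_{n+1} e` except for the last member `s_n e`; the only nontrivial compatibility
is `d_{n+1} s_{n+1} e = e = d_{n+1} s_n e`. -/
lemma degen_lastFace_sub_mul_mem_fullRelations {n : ℕ} (e : Alg E (n + 1))
    {x : Alg E (n + 1)} (hx : x ∈ moore E (n + 1)) :
    (pull E (SimplexCategory.σ (Fin.last n)) (pull E (SimplexCategory.δ (Fin.last (n + 1))) e) - e)
      * x ∈ fullRelations E (n + 1) := by
  have hσ : pull E (SimplexCategory.δ (Fin.last (n + 2)))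
      (pull E (SimplexCategory.σ (Fin.last (n + 1))) e) = e := pull_δ_σ_succ E (Fin.last (n + 1)) e
  have key := sub_mul_mem_fullRelations E hx
    (fun i => if i = Fin.last (n + 2) then pull E (SimplexCategory.σ (Fin.last n).castSucc) e
      else pull E (SimplexCategory.σ (Fin.last (n + 1))) e)
    (fun i => ?_) (fun i => ?_) (fun i => ?_)
  · rw [if_pos rfl, if_neg (by simp [Fin.ext_iff]), map_sub, hσ] at key
    convert key using 3
    rw [pull_comp, pull_comp]
    congr 2
    exact (SimplexCategory.δ_comp_σ_of_gt (n := n) (i := Fin.last (n + 1)) (j := Fin.last n)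
      (by simp [Fin.lt_def])).symm
  · split_ifs <;> exact degen_mem_degenerate E _ _ _
  · rw [if_neg (by simp [Fin.ext_iff]; omega)]
    split_ifs with hi
    · obtain rfl : i = Fin.last (n + 1) := by simpa [Fin.ext_iff] using hi
      rw [pull_δ_σ_self]
      exact (pull_δ_σ_succ E (Fin.last n).castSucc e).symm
    · rfl
  · rw [if_neg (by simp [Fin.ext_iff]; omega), if_neg (by simp [Fin.ext_iff]), sub_self, map_zero]
    exact Subalgebra.zero_mem _

/-- Restriction to the initial vertex. -/
def vertex (n : ℕ) : Alg E n →ₐ[k] Alg E 0 := pull E (SimplexCategory.const ⦋0⦌ ⦋n⦌ 0)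

lemma totalDegen_pull_const {n m : ℕ} (i : Fin (m + 1)) (e : Alg E m) :
    totalDegen E n (pull E (SimplexCategory.const ⦋0⦌ ⦋m⦌ i) e) =
      pull E (SimplexCategory.const ⦋n⦌ ⦋m⦌ i) e := by
  rw [totalDegen, pull_comp]
  rfl

/-- Modulo the relations, `E_n` acts on `NE_n` through the restriction to the initial vertex. -/
theorem totalDegen_vertex_sub_mul_mem_fullRelations {n : ℕ} (e : Alg E (n + 1))
    {x : Alg E (n + 1)} (hx : x ∈ moore E (n + 1)) :
    (totalDegen E (n + 1) (vertex E (n + 1) e) - e) * x ∈ fullRelations E (n + 1) := by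
  have h₁ := degen_lastFace_sub_mul_mem_fullRelations E e hx
  -- The degenerate element `s_n d_{n+1} e` is the intermediary between `e` and its initial vertex.
  have h₂ := const_sub_pull_mul_mem_fullRelations E (Nat.lt_succ_self n)
    (SimplexCategory.σ (Fin.last n)) (pull E (SimplexCategory.δ (Fin.last (n + 1))) e) hx
  have h₃ := Submodule.add_mem _ h₂ h₁
  rw [← add_mul, sub_add_sub_cancel, pull_comp] at h₃
  rw [vertex, totalDegen_pull_const]
  convert h₃ using 5
  exact hom_ext fun v => by simp [SimplexCategory.const, SimplexCategory.δ]

/-- Modulo the relations, `∂NE_1` acts trivially on `NE_n` for `n ≥ 2`. -/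
theorem totalDegen_lastFace_mul_mem_fullRelations {n : ℕ} {y : Alg E 1} (hy : y ∈ moore E 1)
    {x : Alg E (n + 2)} (hx : x ∈ moore E (n + 2)) :
    totalDegen E (n + 2) (lastFace E 0 y) * x ∈ fullRelations E (n + 2) := by
  have h := const_sub_pull_mul_mem_fullRelations E (n := n + 1) (m := 1) (by omega)
    (SimplexCategory.const ⦋n + 2⦌ ⦋1⦌ 1) y hx
  -- At vertex `1` the edge `y` restricts to `d_0 y = 0`, at vertex `0` to `d_1 y`; only the latter
  -- survives.
  rw [pull_eq_zero_of_forall_ne E (SimplexCategory.const ⦋n + 2⦌ ⦋1⦌ 1) 0 _ hy, sub_zero,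
    ← totalDegen_pull_const] at h
  · convert h using 4
    rw [lastFace_eq_pull]
    congr 2
    exact hom_ext fun v => by fin_cases v; rfl
  · intro v e
    exact absurd (congrArg Fin.val e) one_ne_zero

end Action

/-! ### The `B`-module structure and the freeness criterion. -/

section Module

variable {k : Type u} [CommRing k] (E : SimplicialObject (CommAlgCat.{v} k))

lemma totalDegen_mem_degenerate (n : ℕ) (r : Alg E 0) :
    totalDegen E (n + 1) r ∈ degenerate E (n + 1) :=
  pull_mem_degenerate E (Nat.succ_pos n) _ _

lemma pull_totalDegen {n m : ℕ} (f : ⦋n⦌ ⟶ ⦋m⦌) (r : Alg E 0) :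
    pull E f (totalDegen E m r) = totalDegen E n r := by
  rw [totalDegen, pull_comp]
  rfl

lemma totalDegen_mul_mem_fullRelations {n : ℕ} (r : Alg E 0) {x : Alg E (n + 1)}
    (hx : x ∈ fullRelations E (n + 1)) :
    totalDegen E (n + 1) r * x ∈ fullRelations E (n + 1) := by
  obtain ⟨a, ha, _, ⟨y, hy, rfl⟩, rfl⟩ := Submodule.mem_sup.1 hx
  rw [mul_add]
  refine Submodule.add_mem _ (mem_fullRelations_of_degenerate E (Ideal.mul_mem_left _ _ ha.1)
    (Subalgebra.mul_mem _ (totalDegen_mem_degenerate E n r) ha.2)) ?_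
  have := lastFace_mem_fullRelations E (Ideal.mul_mem_left _ (totalDegen E (n + 2) r) hy.1)
    (Subalgebra.mul_mem _ (totalDegen_mem_degenerate E (n + 1) r) hy.2)
  rwa [map_mul, pull_totalDegen] at this

/-- Multiplication by `r : E_0` on `NE_n`. -/
def mooreMul (n : ℕ) (r : Alg E 0) : mooreModule E n →ₗ[k] mooreModule E n where
  toFun x := mooreAct E n r x
  map_add' _ _ := Subtype.ext (mul_add _ _ _)
  map_smul' c _ := Subtype.ext (mul_smul_comm c _ _)

/-- The action of `E_0` on the terms of dimension `n ≥ 3` of the 2-crossed complex. -/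
def termAct {n : ℕ} (hn : 3 ≤ n) : Alg E 0 →+* Module.End k (TwoCrossedTerm E n) where
  toFun r := Submodule.mapQ _ _ (mooreMul E n r) (by
    intro x hx
    obtain ⟨n, rfl⟩ := Nat.exists_eq_add_of_le' hn
    exact totalDegen_mul_mem_fullRelations E r hx)
  map_one' := by
    ext x
    refine congrArg (Submodule.Quotient.mk) (Subtype.ext ?_)
    change totalDegen E n 1 * x.1 = x.1
    rw [map_one, one_mul]
  map_mul' r s := by
    ext x
    refine congrArg (Submodule.Quotient.mk) (Subtype.ext ?_)
    change totalDegen E n (r * s) * x.1 = totalDegen E n r * (totalDegen E n s * x.1)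
    rw [map_mul, mul_assoc]
  map_zero' := by
    ext x
    refine congrArg (Submodule.Quotient.mk) (Subtype.ext ?_)
    change totalDegen E n 0 * x.1 = 0
    rw [map_zero, zero_mul]
  map_add' r s := by
    ext x
    refine congrArg (Submodule.Quotient.mk) (Subtype.ext ?_)
    change totalDegen E n (r + s) * x.1 = totalDegen E n r * x.1 + totalDegen E n s * x.1
    rw [map_add, add_mul]

lemma termMk_eq_zero {n : ℕ} {x : moore E n} :
    termMk E n x = 0 ↔ x.1 ∈ relations E n :=
  Submodule.Quotient.mk_eq_zero _

lemma termMk_eq_iff {n : ℕ} {x y : moore E n} :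
    termMk E n x = termMk E n y ↔ x.1 - y.1 ∈ relations E n :=
  Submodule.Quotient.eq _

lemma termAct_termMk {n : ℕ} (hn : 3 ≤ n) (r : Alg E 0) (x : moore E n) :
    termAct E hn r (termMk E n x) = termMk E n (mooreAct E n r x) := rfl

lemma termMk_add {n : ℕ} (x y : moore E n) :
    termMk E n (x + y) = termMk E n x + termMk E n y := rfl

lemma termMk_surjective (n : ℕ) : Function.Surjective (termMk E n) :=
  Submodule.Quotient.mk_surjective ((relations E n).comap (mooreModule E n).subtype)

variable {B : Type w} [CommRing B] [Algebra k B]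

/-- A criterion for a term of the 2-crossed complex to be free on given elements. -/
theorem isFreeTermOn_of_functionals (ε : Alg E 0 →ₐ[k] B) (hε : Function.Surjective ε)
    (hker : ∀ r, ε r = 0 → ∃ y ∈ moore E 1, lastFace E 0 y = r) {n : ℕ} (hn : 3 ≤ n)
    {ι : Type z} (v : ι → moore E n)
    (hgen : Algebra.adjoin k ((degenerate E n : Set (Alg E n)) ∪ Set.range fun i => (v i).1) = ⊤)
    (δ : ι → Alg E n →+ B) (hδ : ∀ i, ∀ x ∈ relations E n, δ i x = 0)
    (hδ_self : ∀ i r, δ i (totalDegen E n r * (v i).1) = ε r)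
    (hδ_ne : ∀ i j r, i ≠ j → δ i (totalDegen E n r * (v j).1) = 0) :
    IsFreeTermOn E ε n v := by
  have hkill : RingHom.ker (ε : Alg E 0 →+* B) ≤ RingHom.ker (termAct E hn) := by
    intro r hr
    obtain ⟨y, hy, rfl⟩ := hker r hr
    rw [RingHom.mem_ker]
    refine LinearMap.ext fun t => ?_
    obtain ⟨x, rfl⟩ := termMk_surjective E n t
    rw [termAct_termMk, LinearMap.zero_apply, termMk_eq_zero, relations_eq E hn]
    obtain ⟨n, rfl⟩ := Nat.exists_eq_add_of_le' hn
    exact totalDegen_lastFace_mul_mem_fullRelations E hy x.2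
  let act : B →+* Module.End k (TwoCrossedTerm E n) :=
    (ε : Alg E 0 →+* B).liftOfRightInverse (Function.surjInv hε) (Function.rightInverse_surjInv hε)
      ⟨termAct E hn, hkill⟩
  have hact (r : Alg E 0) : act (ε r) = termAct E hn r :=
    (ε : Alg E 0 →+* B).liftOfRightInverse_comp_apply (Function.surjInv hε)
      (Function.rightInverse_surjInv hε) ⟨termAct E hn, hkill⟩ r
  let inst : Module B (TwoCrossedTerm E n) := Module.compHom _ act
  have hsmul (r : Alg E 0) (x : moore E n) :
      ε r • termMk E n x = termMk E n (mooreAct E n r x) := by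
    change act (ε r) (termMk E n x) = _
    rw [hact, termAct_termMk]
  refine ⟨inst, hsmul, ?_⟩
  have hli : LinearIndependent B fun i => termMk E n (v i) := by
    rw [linearIndependent_iff']
    intro s g hg i hi
    choose r hr using fun i => hε (g i)
    have hsum : termMk E n (∑ j ∈ s, mooreAct E n (r j) (v j)) = 0 := by
      rw [← hg]
      simp only [← hr, hsmul]
      exact map_sum (Submodule.mkQ ((relations E n).comap (mooreModule E n).subtype))
        (fun j => mooreAct E n (r j) (v j)) s
    rw [termMk_eq_zero] at hsum
    have h := hδ i _ hsum
    rw [AddSubmonoidClass.coe_finsetSum, map_sum, Finset.sum_eq_single i] at h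
    · rw [← hr]
      exact (hδ_self i (r i)).symm.trans h
    · exact fun j _ hj => hδ_ne i j _ hj.symm
    · exact fun h => absurd hi h
  have hspan : ⊤ ≤ Submodule.span B (Set.range fun i => termMk E n (v i)) := by
    -- Such decompositions are closed under products because every element of `E_n`, not only of
    -- `E_0`, acts on classes by a scalar of `B` (`hmul`). For `e` in the Moore complex, `d` is then
    -- normalized and degenerate, hence a relation.
    have hdec (e : Alg E n) : ∃ d ∈ degenerate E n, ∃ y : moore E n, e = d + y.1 ∧
        termMk E n y ∈ Submodule.span B (Set.range fun i => termMk E n (v i)) := by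
      have he : e ∈ Algebra.adjoin k
          ((degenerate E n : Set (Alg E n)) ∪ Set.range fun i => (v i).1) := by
        rw [hgen]; trivial
      have hmul (e : Alg E n) (y : moore E n)
          (hy : termMk E n y ∈ Submodule.span B (Set.range fun i => termMk E n (v i))) :
          termMk E n (e • y) ∈ Submodule.span B (Set.range fun i => termMk E n (v i)) := by
        have : termMk E n (e • y) = ε (vertex E n e) • termMk E n y := by
          rw [hsmul, eq_comm, termMk_eq_iff, relations_eq E hn]
          obtain ⟨n, rfl⟩ := Nat.exists_eq_add_of_le' hn
          have := totalDegen_vertex_sub_mul_mem_fullRelations E e y.2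
          rwa [sub_mul] at this
        rw [this]
        exact Submodule.smul_mem _ _ hy
      induction he using Algebra.adjoin_induction with
      | mem x hx =>
        rcases hx with hx | ⟨i, rfl⟩
        · exact ⟨x, hx, 0, by simp, Submodule.zero_mem _⟩
        · exact ⟨0, Subalgebra.zero_mem _, v i, by simp, Submodule.subset_span ⟨i, rfl⟩⟩
      | algebraMap c => exact ⟨_, Subalgebra.algebraMap_mem _ c, 0, by simp, Submodule.zero_mem _⟩
      | add a b _ _ ha hb =>
        obtain ⟨d, hd, y, rfl, hy⟩ := ha
        obtain ⟨d', hd', y', rfl, hy'⟩ := hb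
        refine ⟨d + d', Subalgebra.add_mem _ hd hd', y + y', ?_, ?_⟩
        · simp only [Submodule.coe_add]; ring
        · rw [termMk_add]; exact Submodule.add_mem _ hy hy'
      | mul a b _ _ ha hb =>
        obtain ⟨d, hd, y, rfl, hy⟩ := ha
        obtain ⟨d', hd', y', rfl, hy'⟩ := hb
        refine ⟨d * d', Subalgebra.mul_mem _ hd hd', (d' + y'.1) • y + d • y', ?_, ?_⟩
        · simp only [Submodule.coe_add, Submodule.coe_smul, smul_eq_mul]; ring
        · rw [termMk_add]; exact Submodule.add_mem _ (hmul _ _ hy) (hmul _ _ hy')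
    intro t _
    obtain ⟨x, rfl⟩ := termMk_surjective E n t
    obtain ⟨d, hd, y, hxy, hy⟩ := hdec x.1
    have : termMk E n x = termMk E n y := by
      rw [termMk_eq_iff, relations_eq E hn]
      refine mem_fullRelations_of_degenerate E (Ideal.sub_mem _ x.2 y.2) ?_
      rwa [hxy, add_sub_cancel_right]
    rwa [this]
  exact ⟨Module.Basis.mk hli hspan, fun i => Module.Basis.mk_apply hli hspan i⟩

end Module

/-! ### The augmentation ideal and its square. -/

section Augmentation

variable {k : Type u} [CommRing k] (E : SimplicialObject (CommAlgCat.{v} k))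
  {B : Type w} [CommRing B] [Algebra k B] (ε : Alg E 0 →ₐ[k] B)

/-- The augmentation `E_n → B` induced by `ε` and the initial vertex. -/
def aug (n : ℕ) : Alg E n →ₐ[k] B := ε.comp (vertex E n)

/-- The augmentation ideal of `E_n`. -/
def augIdeal (n : ℕ) : Ideal (Alg E n) := RingHom.ker (aug E ε n)

lemma mem_augIdeal {n : ℕ} {x : Alg E n} : x ∈ augIdeal E ε n ↔ aug E ε n x = 0 := Iff.rfl

lemma aug_zero_apply (r : Alg E 0) : aug E ε 0 r = ε r := by
  rw [aug, AlgHom.comp_apply, vertex, SimplexCategory.const_eq_id, pull_id]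

variable {ε}

/-- The element `z - s_0 d_0 z` lies in `NE_1`, with last face `d_1 z - d_0 z`. -/
lemma aug_faces_eq
    (hε : ∀ y ∈ moore E 1, ε (lastFace E 0 y) = 0) (z : Alg E 1) :
    ε (pull E (SimplexCategory.δ 0) z) = ε (pull E (SimplexCategory.δ 1) z) := by
  have h₀ := pull_δ_σ_self E (0 : Fin 1) (pull E (SimplexCategory.δ 0) z)
  have h₁ := pull_δ_σ_succ E (0 : Fin 1) (pull E (SimplexCategory.δ 0) z)
  have := hε (z - pull E (SimplexCategory.σ 0) (pull E (SimplexCategory.δ 0) z)) ?_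
  · rw [lastFace_eq_pull, map_sub, map_sub, sub_eq_zero] at this
    refine Eq.trans ?_ this.symm
    exact congrArg ε h₁.symm
  · refine (mem_moore_succ E).2 fun i => ?_
    obtain rfl : i = 0 := Fin.eq_zero i
    rw [map_sub, sub_eq_zero]
    exact h₀.symm

/-- Vertices `0` and `i` are joined by an edge, whose two faces have equal augmentation. Hence the
augmentation is compatible with all simplicial operators. -/
lemma aug_vertex_eq
    (hε : ∀ y ∈ moore E 1, ε (lastFace E 0 y) = 0) {m : ℕ} (i : Fin (m + 1)) (y : Alg E m) :
    ε (pull E (SimplexCategory.const ⦋0⦌ ⦋m⦌ i) y) = aug E ε m y := by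
  have := aug_faces_eq E hε (pull E (truncMap (SimplexCategory.const ⦋1⦌ ⦋m⦌ i) 1) y)
  rw [pull_comp, pull_comp] at this
  rw [aug, AlgHom.comp_apply, vertex]
  convert this using 4
  · exact hom_ext fun v => by fin_cases v; rfl
  · exact hom_ext fun v => by fin_cases v; rfl

lemma aug_pull
    (hε : ∀ y ∈ moore E 1, ε (lastFace E 0 y) = 0) {n m : ℕ} (f : ⦋n⦌ ⟶ ⦋m⦌) (y : Alg E m) :
    aug E ε n (pull E f y) = aug E ε m y := by
  rw [← aug_vertex_eq E hε (f.toOrderHom 0) y]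
  rw [aug, AlgHom.comp_apply, vertex, pull_comp]
  rfl

lemma aug_totalDegen
    (hε : ∀ y ∈ moore E 1, ε (lastFace E 0 y) = 0)
    (n : ℕ) (r : Alg E 0) : aug E ε n (totalDegen E n r) = ε r := by
  rw [totalDegen, aug_pull E hε, aug_zero_apply]

lemma pull_mem_augIdeal
    (hε : ∀ y ∈ moore E 1, ε (lastFace E 0 y) = 0)
    {n m : ℕ} (f : ⦋n⦌ ⟶ ⦋m⦌) {y : Alg E m} (hy : y ∈ augIdeal E ε m) :
    pull E f y ∈ augIdeal E ε n := by
  rwa [mem_augIdeal, aug_pull E hε]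

lemma pull_mem_augIdeal_sq
    (hε : ∀ y ∈ moore E 1, ε (lastFace E 0 y) = 0) {n m : ℕ} (f : ⦋n⦌ ⟶ ⦋m⦌) {y : Alg E m}
    (hy : y ∈ augIdeal E ε m ^ 2) : pull E f y ∈ augIdeal E ε n ^ 2 := by
  have h : (augIdeal E ε m).map (pull E f) ≤ augIdeal E ε n :=
    Ideal.map_le_iff_le_comap.2 fun y hy => pull_mem_augIdeal E hε f hy
  refine Ideal.pow_right_mono h 2 ?_
  rw [← Ideal.map_pow]
  exact Ideal.mem_map_of_mem _ hy

/-- The augmentation may be computed at the last vertex, and the inclusion of that vertex misses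
vertex `0`. -/
lemma moore_le_augIdeal
    (hε : ∀ y ∈ moore E 1, ε (lastFace E 0 y) = 0)
    (n : ℕ) : moore E (n + 1) ≤ augIdeal E ε (n + 1) := by
  intro x hx
  rw [mem_augIdeal, ← aug_vertex_eq E hε (Fin.last (n + 1)),
    pull_eq_zero_of_forall_ne E _ 0 (fun v e => ?_) hx, map_zero]
  exact absurd (congrArg Fin.val e) (Nat.succ_ne_zero n)

/-- The subgroup of `E_{n+1}` generated by the degeneracies `s_i y`, with `y` in the augmentation
ideal and `i ≥ j`, and by the square of the augmentation ideal. -/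
def degenSubgroup (ε : Alg E 0 →ₐ[k] B) (n j : ℕ) : AddSubgroup (Alg E (n + 1)) :=
  AddSubgroup.closure
    ({x | ∃ i : Fin (n + 1), j ≤ i ∧ ∃ y ∈ augIdeal E ε n, x = pull E (SimplexCategory.σ i) y} ∪
      (augIdeal E ε (n + 1) ^ 2 : Ideal (Alg E (n + 1))))

lemma degen_mem_degenSubgroup {n j : ℕ} (i : Fin (n + 1)) (hi : j ≤ i) {y : Alg E n}
    (hy : y ∈ augIdeal E ε n) : pull E (SimplexCategory.σ i) y ∈ degenSubgroup E ε n j :=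
  AddSubgroup.subset_closure (Or.inl ⟨i, hi, y, hy, rfl⟩)

lemma sq_le_degenSubgroup {n j : ℕ} {x : Alg E (n + 1)} (hx : x ∈ augIdeal E ε (n + 1) ^ 2) :
    x ∈ degenSubgroup E ε n j :=
  AddSubgroup.subset_closure (Or.inr hx)

lemma mem_augIdeal_of_mem_degenSubgroup
    (hε : ∀ y ∈ moore E 1, ε (lastFace E 0 y) = 0) {n j : ℕ} {x : Alg E (n + 1)}
    (hx : x ∈ degenSubgroup E ε n j) : x ∈ augIdeal E ε (n + 1) := by
  induction hx using AddSubgroup.closure_induction with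
  | mem x hx =>
    rcases hx with ⟨i, _, y, hy, rfl⟩ | hx
    · exact pull_mem_augIdeal E hε _ hy
    · exact Ideal.pow_le_self two_ne_zero hx
  | zero => exact Ideal.zero_mem _
  | add _ _ _ _ ha hb => exact Ideal.add_mem _ ha hb
  | neg _ _ ha => exact Ideal.neg_mem_iff _ |>.2 ha

lemma totalDegen_mul_mem_degenSubgroup {n j : ℕ} (r : Alg E 0) {x : Alg E (n + 1)}
    (hx : x ∈ degenSubgroup E ε n j) :
    totalDegen E (n + 1) r * x ∈ degenSubgroup E ε n j := by
  induction hx using AddSubgroup.closure_induction with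
  | mem x hx =>
    rcases hx with ⟨i, hi, y, hy, rfl⟩ | hx
    · rw [← pull_totalDegen E (SimplexCategory.σ i), ← map_mul]
      exact degen_mem_degenSubgroup E i hi (Ideal.mul_mem_left _ _ hy)
    · exact sq_le_degenSubgroup E (Ideal.mul_mem_left _ _ hx)
  | zero => rw [mul_zero]; exact AddSubgroup.zero_mem _
  | add _ _ _ _ ha hb => rw [mul_add]; exact AddSubgroup.add_mem _ ha hb
  | neg _ _ ha => rw [mul_neg]; exact AddSubgroup.neg_mem _ ha

/-- `D` is generated by degeneracies as an algebra, not additively. Once constants from `E_0` are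
split off, products of the remainders fall into the square of the augmentation ideal, so additive
generation suffices. -/
lemma exists_sub_totalDegen_mem_degenSubgroup
    (hε : ∀ y ∈ moore E 1, ε (lastFace E 0 y) = 0) {n : ℕ} {x : Alg E (n + 1)}
    (hx : x ∈ degenerate E (n + 1)) :
    ∃ c, x - totalDegen E (n + 1) c ∈ degenSubgroup E ε n 0 := by
  induction hx using Algebra.adjoin_induction with
  | mem x hx =>
    obtain ⟨i, y, rfl⟩ := hx
    refine ⟨vertex E n y, ?_⟩
    rw [degen_eq_pull, ← pull_totalDegen E (SimplexCategory.σ i), ← map_sub]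
    refine degen_mem_degenSubgroup E i (Nat.zero_le _) ?_
    rw [mem_augIdeal, map_sub, aug_totalDegen E hε, sub_eq_zero]
    rfl
  | algebraMap c => exact ⟨algebraMap k _ c, by simp⟩
  | add x y _ _ hx hy =>
    obtain ⟨c, hc⟩ := hx
    obtain ⟨d, hd⟩ := hy
    refine ⟨c + d, ?_⟩
    rw [map_add, add_sub_add_comm]
    exact AddSubgroup.add_mem _ hc hd
  | mul x y _ _ hx hy =>
    obtain ⟨c, hc⟩ := hx
    obtain ⟨d, hd⟩ := hy
    refine ⟨c * d, ?_⟩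
    have : x * y - totalDegen E (n + 1) (c * d) =
        (x - totalDegen E (n + 1) c) * (y - totalDegen E (n + 1) d) +
        totalDegen E (n + 1) d * (x - totalDegen E (n + 1) c) +
        totalDegen E (n + 1) c * (y - totalDegen E (n + 1) d) := by
      rw [map_mul]; ring
    rw [this]
    refine AddSubgroup.add_mem _ (AddSubgroup.add_mem _ (sq_le_degenSubgroup E ?_)
      (totalDegen_mul_mem_degenSubgroup E _ hc)) (totalDegen_mul_mem_degenSubgroup E _ hd)
    rw [pow_two]
    exact Ideal.mul_mem_mul (mem_augIdeal_of_mem_degenSubgroup E hε hc)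
      (mem_augIdeal_of_mem_degenSubgroup E hε hd)

lemma mem_degenSubgroup_zero
    (hε : ∀ y ∈ moore E 1, ε (lastFace E 0 y) = 0)
    {n : ℕ} {x : Alg E (n + 1)} (hx : x ∈ degenerate E (n + 1))
    (h : x ∈ augIdeal E ε (n + 1)) : x ∈ degenSubgroup E ε n 0 := by
  obtain ⟨c, hc⟩ := exists_sub_totalDegen_mem_degenSubgroup E hε hx
  have h₁ := mem_augIdeal_of_mem_degenSubgroup E hε hc
  rw [mem_augIdeal, map_sub, (mem_augIdeal E ε).1 h, zero_sub, neg_eq_zero,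
    aug_totalDegen E hε] at h₁
  rw [← sub_add_cancel x (totalDegen E (n + 1) c)]
  refine AddSubgroup.add_mem _ hc ?_
  rw [← pull_totalDegen E (SimplexCategory.σ 0)]
  exact degen_mem_degenSubgroup E 0 (Nat.zero_le _)
    ((mem_augIdeal E ε).2 ((aug_totalDegen E hε n c).trans h₁))

/-- The operator `1 - s_j d_j` kills degeneracies `s_j y` and preserves the span of the later ones
modulo squares. It fixes normalized elements, so iterating it removes all degeneracies from them. -/
lemma sub_degen_face_mem_degenSubgroup
    (hε : ∀ y ∈ moore E 1, ε (lastFace E 0 y) = 0) {n : ℕ} (j : Fin (n + 1)) {x : Alg E (n + 1)}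
    (hx : x ∈ degenSubgroup E ε n j) :
    x - pull E (SimplexCategory.σ j) (pull E (SimplexCategory.δ j.castSucc) x) ∈
      degenSubgroup E ε n (j + 1) := by
  induction hx using AddSubgroup.closure_induction with
  | mem x hx =>
    rcases hx with ⟨i, hi, y, hy, rfl⟩ | hx
    · obtain rfl | hij := eq_or_ne j i
      · rw [pull_δ_σ_self, sub_self]
        exact AddSubgroup.zero_mem _
      · have hlt : (j : ℕ) < i := lt_of_le_of_ne hi fun e => hij (Fin.ext e)
        refine AddSubgroup.sub_mem _ (degen_mem_degenSubgroup E i hlt hy) ?_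
        rw [pull_comp, pull_comp]
        -- For `j < i` the composite identifies the vertices `i` and `i + 1`, so it factors through
        -- `σ i`.
        obtain ⟨θ, hθ⟩ := SimplexCategory.eq_σ_comp_of_not_injective'
          ((SimplexCategory.σ j ≫ SimplexCategory.δ j.castSucc) ≫ SimplexCategory.σ i) i (by
            refine Fin.ext ?_
            rw [comp_apply, comp_apply, comp_apply, comp_apply, σ_apply_val, σ_apply_val,
              δ_apply_val, δ_apply_val, σ_apply_val, σ_apply_val]
            simp only [Fin.val_castSucc, Fin.val_succ]
            split_ifs <;> omega)
        rw [hθ, ← pull_comp]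
        exact degen_mem_degenSubgroup E i hlt (pull_mem_augIdeal E hε θ hy)
    · exact sq_le_degenSubgroup E (Ideal.sub_mem _ hx
        (pull_mem_augIdeal_sq E hε _ (pull_mem_augIdeal_sq E hε _ hx)))
  | zero => simp
  | add a b _ _ ha hb =>
    rw [map_add, map_add, add_sub_add_comm]
    exact AddSubgroup.add_mem _ ha hb
  | neg a _ ha =>
    rw [map_neg, map_neg, neg_sub_neg, ← neg_sub]
    exact AddSubgroup.neg_mem _ ha

/-- Modulo the square of the augmentation ideal, a degenerate element of the Moore complex
vanishes. -/
theorem mem_augIdeal_sq_of_mem_moore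
    (hε : ∀ y ∈ moore E 1, ε (lastFace E 0 y) = 0)
    {n : ℕ} {x : Alg E (n + 1)} (hx : x ∈ moore E (n + 1))
    (h : x ∈ degenerate E (n + 1)) : x ∈ augIdeal E ε (n + 1) ^ 2 := by
  have key (j : ℕ) (hj : j ≤ n + 1) : x ∈ degenSubgroup E ε n j := by
    induction j with
    | zero => exact mem_degenSubgroup_zero E hε h (moore_le_augIdeal E hε n hx)
    | succ j ih =>
      have := sub_degen_face_mem_degenSubgroup E hε (⟨j, hj⟩ : Fin (n + 1))
        (ih (Nat.le_of_succ_le hj))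
      rwa [(mem_moore_succ E).1 hx, map_zero, sub_zero] at this
  refine (AddSubgroup.closure_le (augIdeal E ε (n + 1) ^ 2).toAddSubgroup).2 ?_ (key (n + 1) le_rfl)
  rintro y (⟨i, hi, _⟩ | hy)
  · exact absurd hi (by omega)
  · exact hy

end Augmentation

/-! ### Coordinate functionals with values in the dual numbers. -/

section Functional

variable {k : Type u} [CommRing k] {E : SimplicialObject (CommAlgCat.{v} k)}
  (X : ConstructionData.{u, v, z} E) {B : Type w} [CommRing B] [Algebra k B]

/-- The index set of the polynomial generators of `E_n`. -/
abbrev ConstructionData.Index (n : ℕ) : Type z :=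
  Σ m : ℕ, {f : ⦋n⦌ ⟶ ⦋m⦌ // Epi f} × X.gen m

/-- The polynomial generators of `E_n`. -/
def ConstructionData.basic (n : ℕ) (p : X.Index n) : Alg E n := pull E p.2.1.1 (X.elt p.1 p.2.2)

/-- The index of a generator of dimension `n` among the polynomial generators of `E_n`. -/
def ConstructionData.index (n : ℕ) (s : X.gen n) : X.Index n :=
  ⟨n, ⟨𝟙 _, inferInstance⟩, s⟩

lemma ConstructionData.basic_index (n : ℕ) (s : X.gen n) :
    X.basic n (X.index n s) = X.elt n s := pull_id E _

lemma ConstructionData.index_injective (n : ℕ) : Function.Injective (X.index n) := by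
  intro s t h
  simpa [index] using h

/-- The presentation of `E_n` as a polynomial algebra. -/
noncomputable def ConstructionData.equiv (n : ℕ) :
    MvPolynomial (X.Index n) k ≃ₐ[k] Alg E n :=
  AlgEquiv.ofBijective (MvPolynomial.aeval (X.basic n)) (X.free n)

lemma ConstructionData.algHom_ext {n : ℕ} {A : Type*} [Semiring A] [Algebra k A]
    {f g : Alg E n →ₐ[k] A} (h : ∀ p, f (X.basic n p) = g (X.basic n p)) : f = g := by
  have : f.comp (MvPolynomial.aeval (X.basic n)) = g.comp (MvPolynomial.aeval (X.basic n)) :=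
    MvPolynomial.algHom_ext fun p => by simpa using h p
  refine AlgHom.ext fun x => ?_
  obtain ⟨q, rfl⟩ := (X.free n).2 x
  exact DFunLike.congr_fun this q

lemma ConstructionData.adjoin_basic (n : ℕ) : Algebra.adjoin k (Set.range (X.basic n)) = ⊤ := by
  rw [Algebra.adjoin_range_eq_range_aeval]
  exact (AlgHom.range_eq_top _).2 (X.free n).2

lemma ConstructionData.basic_cases {n : ℕ} (p : X.Index n) :
    (∃ s, p = X.index n s) ∨ p.1 < n := by
  obtain ⟨m, ⟨f, hf⟩, s⟩ := p
  obtain rfl | hlt := (SimplexCategory.len_le_of_epi (f := f)).eq_or_lt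
  · obtain rfl := SimplexCategory.eq_id_of_epi f
    exact Or.inl ⟨s, rfl⟩
  · exact Or.inr hlt

variable (ε : Alg E 0 →ₐ[k] B)

open Classical in
/-- The algebra homomorphism `E_n → B[ε]` over the augmentation that sends the generator `s` to
`ε` and the other polynomial generators to their augmentations. -/
noncomputable def ConstructionData.toDual (n : ℕ) (s : X.gen n) :
    Alg E n →ₐ[k] TrivSqZeroExt B B :=
  (MvPolynomial.aeval fun p => (TrivSqZeroExt.inl (aug E ε n (X.basic n p)) +
    if p = X.index n s then TrivSqZeroExt.inr 1 else 0 : TrivSqZeroExt B B)).comp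
      (X.equiv n).symm.toAlgHom

open Classical in
lemma ConstructionData.toDual_basic (n : ℕ) (s : X.gen n) (p : X.Index n) :
    X.toDual ε n s (X.basic n p) = TrivSqZeroExt.inl (aug E ε n (X.basic n p)) +
      if p = X.index n s then TrivSqZeroExt.inr 1 else 0 := by
  have : (X.equiv n).symm (X.basic n p) = MvPolynomial.X p := by
    rw [AlgEquiv.symm_apply_eq]
    exact (MvPolynomial.aeval_X _ _).symm
  change MvPolynomial.aeval _ ((X.equiv n).symm (X.basic n p)) = _
  rw [this, MvPolynomial.aeval_X]

lemma ConstructionData.fst_toDual (n : ℕ) (s : X.gen n) (x : Alg E n) :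
    (X.toDual ε n s x).fst = aug E ε n x := by
  have : (TrivSqZeroExt.fstHom k B B).comp (X.toDual ε n s) = aug E ε n := by
    refine X.algHom_ext fun p => ?_
    rw [AlgHom.comp_apply, X.toDual_basic]
    split_ifs <;> simp
  exact DFunLike.congr_fun this x

/-- A degeneracy of a polynomial generator is again a polynomial generator, coming from a dimension
at most `n`, so it differs from `s`. -/
lemma ConstructionData.snd_toDual_of_degenerate {n : ℕ} (s : X.gen (n + 1)) {x : Alg E (n + 1)}
    (hx : x ∈ degenerate E (n + 1)) : (X.toDual ε (n + 1) s x).snd = 0 := by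
  suffices h : degenerate E (n + 1) ≤ AlgHom.equalizer (X.toDual ε (n + 1) s)
      ((TrivSqZeroExt.inlAlgHom k B B).comp (aug E ε (n + 1))) by
    have := h hx
    rw [AlgHom.mem_equalizer] at this
    rw [this]
    exact TrivSqZeroExt.snd_inl _ _
  refine Algebra.adjoin_le ?_
  rintro _ ⟨i, y, rfl⟩
  suffices h : (X.toDual ε (n + 1) s).comp (degen E n i) =
      ((TrivSqZeroExt.inlAlgHom k B B).comp (aug E ε (n + 1))).comp (degen E n i) from
    DFunLike.congr_fun h y
  refine X.algHom_ext fun p => ?_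
  obtain ⟨m, ⟨f, hf⟩, t⟩ := p
  have hq : degen E n i (X.basic n ⟨m, ⟨f, hf⟩, t⟩) =
      X.basic (n + 1) ⟨m, ⟨SimplexCategory.σ i ≫ f, epi_comp _ _⟩, t⟩ := pull_comp E _ _ _
  rw [AlgHom.comp_apply, AlgHom.comp_apply, AlgHom.comp_apply, hq, X.toDual_basic,
    if_neg, add_zero]
  · rfl
  · intro h
    have h₁ : m = n + 1 := congrArg Sigma.fst h
    have h₂ : m ≤ n := SimplexCategory.len_le_of_epi (f := f)
    omega

lemma ConstructionData.toDual_of_mem_sq {n : ℕ} (s : X.gen n) {x : Alg E n}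
    (hx : x ∈ augIdeal E ε n ^ 2) : X.toDual ε n s x = 0 := by
  suffices h : augIdeal E ε n ^ 2 ≤ RingHom.ker (X.toDual ε n s) from h hx
  rw [pow_two, Ideal.mul_le]
  intro a ha b hb
  rw [RingHom.mem_ker, map_mul]
  have ha' := (X.fst_toDual ε n s a).trans ha
  have hb' := (X.fst_toDual ε n s b).trans hb
  refine TrivSqZeroExt.ext ?_ ?_
  · simp [ha']
  · simp [ha', hb']

/-- The `B`-valued functional on `E_n` dual to the generator `s`. -/
noncomputable def ConstructionData.coord (n : ℕ) (s : X.gen n) : Alg E n →+ B :=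
  (TrivSqZeroExt.sndHom B B).toAddMonoidHom.comp (X.toDual ε n s : Alg E n →+ TrivSqZeroExt B B)

lemma ConstructionData.coord_apply (n : ℕ) (s : X.gen n) (x : Alg E n) :
    X.coord ε n s x = (X.toDual ε n s x).snd := rfl

variable {ε}

/-- `NE ∩ D` is handled by degeneracy. For its boundary from one dimension up, `NE ∩ D` lies in the
square of the augmentation ideal, and faces preserve that square. -/
lemma ConstructionData.coord_of_mem_fullRelations
    (hε : ∀ y ∈ moore E 1, ε (lastFace E 0 y) = 0) {n : ℕ} (s : X.gen (n + 1))
    {x : Alg E (n + 1)} (hx : x ∈ fullRelations E (n + 1)) : X.coord ε (n + 1) s x = 0 := by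
  obtain ⟨a, ha, _, ⟨y, hy, rfl⟩, rfl⟩ := Submodule.mem_sup.1 hx
  have h : X.toDual ε (n + 1) s (pull E (SimplexCategory.δ (Fin.last (n + 2))) y) = 0 :=
    X.toDual_of_mem_sq ε s (pull_mem_augIdeal_sq E hε _
      (mem_augIdeal_sq_of_mem_moore E hε hy.1 hy.2))
  rw [map_add, coord_apply, X.snd_toDual_of_degenerate ε s ha.2, zero_add, coord_apply]
  exact congrArg TrivSqZeroExt.snd h

open Classical in
lemma ConstructionData.coord_totalDegen_mul_elt
    (hε : ∀ y ∈ moore E 1, ε (lastFace E 0 y) = 0) {n : ℕ} (s t : X.gen (n + 1)) (r : Alg E 0) :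
    X.coord ε (n + 1) s (totalDegen E (n + 1) r * X.elt (n + 1) t) = if t = s then ε r else 0 := by
  have h₁ := X.fst_toDual ε (n + 1) s (totalDegen E (n + 1) r)
  rw [aug_totalDegen E hε] at h₁
  have h₂ : aug E ε (n + 1) (X.elt (n + 1) t) = 0 :=
    moore_le_augIdeal E hε n (X.elt_mem_moore (n + 1) t)
  rw [coord_apply, map_mul, ← X.basic_index (n + 1) t, X.toDual_basic, X.basic_index, h₂,
    TrivSqZeroExt.snd_mul, h₁,
    X.snd_toDual_of_degenerate ε s (totalDegen_mem_degenerate E n r)]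
  by_cases h : t = s
  · subst h
    simp
  · rw [if_neg h, if_neg fun e => h (X.index_injective _ e)]
    simp

lemma ConstructionData.adjoin_degenerate_elt (n : ℕ) :
    Algebra.adjoin k ((degenerate E n : Set (Alg E n)) ∪ Set.range (X.elt n)) = ⊤ := by
  rw [eq_top_iff, ← X.adjoin_basic n]
  refine Algebra.adjoin_mono ?_
  rintro _ ⟨p, rfl⟩
  obtain ⟨s, rfl⟩ | h := X.basic_cases p
  · exact Or.inr ⟨s, (X.basic_index n s).symm⟩
  · exact Or.inl (pull_mem_degenerate E h _ _)

theorem ConstructionData.isFreeTermOn (hE : IsResolution E ε) {n : ℕ} (hn : 3 ≤ n) :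
    IsFreeTermOn E ε n (X.mooreElt n) := by
  classical
  have hε : ∀ y ∈ moore E 1, ε (lastFace E 0 y) = 0 := fun y hy =>
    (hE.ker_eq _).2 ⟨y, hy, rfl⟩
  obtain ⟨n, rfl⟩ := Nat.exists_eq_add_of_le' (show 1 ≤ n by omega)
  refine isFreeTermOn_of_functionals E ε hE.surjective (fun r => (hE.ker_eq r).1) hn _
    (X.adjoin_degenerate_elt _) (X.coord ε (n + 1)) (fun s x hx => ?_) (fun s r => ?_)
    (fun s t r hst => ?_)
  · rw [relations_eq E hn] at hx
    exact X.coord_of_mem_fullRelations hε s hx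
  · exact (X.coord_totalDegen_mul_elt hε s s r).trans (if_pos rfl)
  · exact (X.coord_totalDegen_mul_elt hε s t r).trans (if_neg hst.symm)

end Functional

/-! ### Transfer to the skeleta. -/

section Skeleton

variable {k : Type u} [CommRing k] {E : SimplicialObject (CommAlgCat.{v} k)}

lemma pull_mem_skelAlg {m n j : ℕ} (hj : j ≤ m) (f : ⦋n⦌ ⟶ ⦋j⦌) (y : Alg E j) :
    pull E f y ∈ skelAlg E m n :=
  Algebra.subset_adjoin ⟨j, hj, f, y, rfl⟩

lemma mem_skelAlg_of_le {m n : ℕ} (h : n ≤ m) (y : Alg E n) : y ∈ skelAlg E m n := by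
  have := pull_mem_skelAlg h (𝟙 _) y
  rwa [pull_id] at this

lemma pull_skelIncl {m a b : ℕ} (f : ⦋a⦌ ⟶ ⦋b⦌) (x : Alg (skel E m) b) :
    pull E f (skelIncl E m b x) = skelIncl E m a (pull (skel E m) f x) := rfl

lemma skelIncl_injective (m n : ℕ) : Function.Injective (skelIncl E m n) :=
  Subtype.val_injective

lemma skelIncl_mem_moore {m n : ℕ} {x : Alg (skel E m) n} :
    skelIncl E m n x ∈ moore E n ↔ x ∈ moore (skel E m) n := by
  obtain _ | n := n
  · exact iff_of_true Submodule.mem_top Submodule.mem_top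
  · rw [mem_moore_succ, mem_moore_succ]
    refine forall_congr' fun i => ?_
    rw [pull_skelIncl, map_eq_zero_iff _ (skelIncl_injective m n)]

lemma skelIncl_mem_degenerate {m n : ℕ} {x : Alg (skel E m) n}
    (hx : x ∈ degenerate (skel E m) n) : skelIncl E m n x ∈ degenerate E n := by
  suffices h : degenerate (skel E m) n ≤ (degenerate E n).comap (skelIncl E m n) from h hx
  obtain _ | n := n
  · exact bot_le
  · refine Algebra.adjoin_le ?_
    rintro _ ⟨i, y, rfl⟩
    exact degen_mem_degenerate E n i (skelIncl E m n y)

lemma skelIncl_mem_fullRelations {m n : ℕ} {x : Alg (skel E m) n}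
    (hx : x ∈ fullRelations (skel E m) n) : skelIncl E m n x ∈ fullRelations E n := by
  obtain ⟨a, ha, _, ⟨y, hy, rfl⟩, rfl⟩ := Submodule.mem_sup.1 hx
  rw [map_add]
  exact Submodule.add_mem _
    (mem_fullRelations_of_degenerate E (skelIncl_mem_moore.2 ha.1) (skelIncl_mem_degenerate ha.2))
    (lastFace_mem_fullRelations E (skelIncl_mem_moore.2 hy.1) (skelIncl_mem_degenerate hy.2))

/-- For `n ≤ m` the skeleton is all of `E_n`, and its lower-dimensional generators are degenerate in
the skeleton too. For `n > m` every defining generator of the skeleton is degenerate. -/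
lemma ConstructionData.skel_adjoin_eq_top (X : ConstructionData.{u, v, z} E) (m n : ℕ) :
    Algebra.adjoin k ((degenerate (skel E m) n : Set (Alg (skel E m) n)) ∪
      Set.range fun s => (X.skelElt m n s).1) = ⊤ := by
  set S := Algebra.adjoin k ((degenerate (skel E m) n : Set (Alg (skel E m) n)) ∪
      Set.range fun s => (X.skelElt m n s).1) with hS
  have hdeg {j : ℕ} (hjn : j < n) (hjm : j ≤ m) (f : ⦋n⦌ ⟶ ⦋j⦌) (y : Alg E j) :
      pull E f y ∈ S.map (skelIncl E m n) :=
    ⟨pull (skel E m) f ⟨y, mem_skelAlg_of_le hjm y⟩,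
      Algebra.subset_adjoin (Or.inl (pull_mem_degenerate _ hjn _ _)), rfl⟩
  have hle : skelAlg E m n ≤ S.map (skelIncl E m n) := by
    obtain hnm | hmn := le_or_gt n m
    · refine le_top.trans ?_
      rw [← X.adjoin_basic n]
      refine Algebra.adjoin_le ?_
      rintro _ ⟨p, rfl⟩
      obtain ⟨s, rfl⟩ | h := X.basic_cases p
      · rw [X.basic_index]
        exact ⟨_, Algebra.subset_adjoin (Or.inr ⟨⟨s, hnm⟩, rfl⟩), rfl⟩
      · exact hdeg h (h.le.trans hnm) _ _
    · refine Algebra.adjoin_le ?_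
      rintro _ ⟨j, hj, f, y, rfl⟩
      exact hdeg (hj.trans_lt hmn) hj f y
  refine eq_top_iff.2 fun x _ => ?_
  obtain ⟨y, hy, hyx⟩ := hle (Subtype.property x)
  rwa [← skelIncl_injective m n hyx]

theorem ConstructionData.isFreeTermOn_skel (X : ConstructionData.{u, v, z} E) {B : Type w}
    [CommRing B] [Algebra k B] {ε : Alg E 0 →ₐ[k] B} (hE : IsResolution E ε) {m n : ℕ}
    (hm : 1 ≤ m) (hn : 3 ≤ n) :
    IsFreeTermOn (skel E m) (ε.comp (skelIncl E m 0)) n (X.skelElt m n) := by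
  classical
  have hε : ∀ y ∈ moore E 1, ε (lastFace E 0 y) = 0 := fun y hy =>
    (hE.ker_eq _).2 ⟨y, hy, rfl⟩
  obtain ⟨n, rfl⟩ := Nat.exists_eq_add_of_le' (show 1 ≤ n by omega)
  refine isFreeTermOn_of_functionals (skel E m) _ (fun b => ?_) (fun r hr => ?_) hn _
    (X.skel_adjoin_eq_top m _)
    (fun s => (X.coord ε (n + 1) s.1).comp (skelIncl E m (n + 1) : _ →+ Alg E (n + 1)))
    (fun s x hx => ?_) (fun s r => ?_) (fun s t r hst => ?_)
  · obtain ⟨r, rfl⟩ := hE.surjective b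
    exact ⟨⟨r, mem_skelAlg_of_le (Nat.zero_le m) r⟩, rfl⟩
  · obtain ⟨y, hy, hyr⟩ := (hE.ker_eq _).1 hr
    -- Here `1 ≤ m` is needed: the edge that witnesses `ε r = 0` must belong to the skeleton.
    refine ⟨⟨y, mem_skelAlg_of_le hm y⟩, skelIncl_mem_moore.1 hy, skelIncl_injective m 0 hyr⟩
  · rw [relations_eq _ hn] at hx
    exact X.coord_of_mem_fullRelations hε s.1 (skelIncl_mem_fullRelations hx)
  · exact (X.coord_totalDegen_mul_elt hε s.1 s.1 (skelIncl E m 0 r)).trans (if_pos rfl)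
  · exact (X.coord_totalDegen_mul_elt hε s.1 t.1 (skelIncl E m 0 r)).trans
      (if_neg fun h => hst (Subtype.ext h.symm))

end Skeleton

end SimplicialAlgebra

theorem mainTheorem9 {k : Type u} [CommRing k] {B : Type w} [CommRing B] [Algebra k B]
    (E : SimplicialObject (CommAlgCat.{v} k))
    (X : SimplicialAlgebra.ConstructionData.{u, v, z} E)
    (ε : SimplicialAlgebra.Alg E 0 →ₐ[k] B) (hE : SimplicialAlgebra.IsResolution E ε)
    (n : ℕ) (hn : 3 ≤ n) :
    (∀ m : ℕ, 1 ≤ m →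
      SimplicialAlgebra.IsFreeTermOn (SimplicialAlgebra.skel E m)
        (ε.comp (SimplicialAlgebra.skelIncl E m 0)) n (X.skelElt m n)) ∧
    SimplicialAlgebra.IsFreeTermOn E ε n (X.mooreElt n) :=
  ⟨fun _ hm => X.isFreeTermOn_skel hE hm hn, X.isFreeTermOn hE hn⟩
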